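/- Let $Z$ be a countable set of letters equipped with a total order, let $\mathbb{Q}Z$ be the $\mathbb{Q}$-vector space with basis $Z$, and let $\lozenge$ be a $\mathbb{Q}$-bilinear, commutative and associative product on $\mathbb{Q}Z$. Let $\mathbb{Q}\langle Z\rangle$ be the space of non-commutative polynomials in $Z$, with the words in $Z$ (including the empty word $1$) as basis. For $c\in\mathbb{Q}Z$ let $L_c:\mathbb{Q}\langle Z\rangle\to\mathbb{Q}\langle Z\rangle$ be the linear map with $L_c(1)=0$ and $L_c(xw)=(c\lozenge x)w$ for every letter $x$ and word $w$. Let $\star$ be the generalised quasi-shuffle product, that is, the bilinear product on $\mathbb{Q}\langle Z\rangle$ defined recursively by \[ w\star 1=1\star w=w,\qquad au\star bv=a(u\star bv)+b(au\star v)-L_{a\lozenge b}(u\star v) \] for $a,b\in Z$ and words $u,v,w$. A word is called a Lyndon word if it is non-empty and strictly smaller, in the lexicographic order (in which a proper prefix of a word is smaller than the word), than each of its proper non-empty right factors. Then $(\mathbb{Q}\langle Z\rangle,\star)$ is the free polynomial algebra on the Lyndon words. That is, there is a $\mathbb{Q}$-linear bijection from the commutative polynomial ring $\mathbb{Q}[X_w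 : w \text{ a Lyndon word in } Z]$ onto $\mathbb{Q}\langle Z\rangle$ which sends $1$ to the empty word, sends products of polynomials to $\star$-products, and sends each variable $X_w$ to the word $w$. -/

import Mathlib

namespace GenQuasiShuffle

/-- The space `k⟨Z⟩` of non-commutative polynomials over `k` in the letters `Z`: it has the words
in `Z` as a basis, and its ring multiplication `*` is concatenation. -/
abbrev NCPoly (k Z : Type*) [Field k] : Type _ := MonoidAlgebra k (FreeMonoid Z)

section
variable {k Z : Type*} [Field k]

/-- A word (a list of letters) as a monomial in `k⟨Z⟩`. -/
noncomputable def word (k : Type*) {Z : Type*} [Field k] (w : List Z) : NCPoly k Z :=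
  MonoidAlgebra.of k (FreeMonoid Z) (FreeMonoid.ofList w)

/-- The linear map out of `k⟨Z⟩` with prescribed values on words. -/
noncomputable def wordLift {M : Type*} [AddCommGroup M] [Module k M] (f : List Z → M) :
    NCPoly k Z →ₗ[k] M :=
  (Finsupp.linearCombination k fun w : FreeMonoid Z => f w.toList) ∘ₗ
    (MonoidAlgebra.coeffLinearEquiv k).toLinearMap

/-- The inclusion `kZ → k⟨Z⟩` of the span of the letters. -/
noncomputable def letters : (Z →₀ k) →ₗ[k] NCPoly k Z :=
  Finsupp.linearCombination k fun z => word k [z]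

/-- For a bilinear product `d` on `kZ` and `c ∈ kZ`, the map `L_c : k⟨Z⟩ → k⟨Z⟩` with
`L_c 1 = 0` and `L_c (x w) = (d c x) w` for a letter `x` and a word `w`. -/
noncomputable def L (d : (Z →₀ k) →ₗ[k] (Z →₀ k) →ₗ[k] (Z →₀ k)) (c : Z →₀ k) :
    NCPoly k Z →ₗ[k] NCPoly k Z :=
  wordLift fun w => match w with
    | [] => 0
    | x :: w => letters (d c (Finsupp.single x 1)) * word k w

/-- The generalised quasi-shuffle product of two words. -/
noncomputable def starWord (d : (Z →₀ k) →ₗ[k] (Z →₀ k) →ₗ[k] (Z →₀ k)) :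
    List Z → List Z → NCPoly k Z
  | [], v => word k v
  | a :: u, [] => word k (a :: u)
  | a :: u, b :: v =>
      word k [a] * starWord d u (b :: v) + word k [b] * starWord d (a :: u) v
        - L d (d (Finsupp.single a 1) (Finsupp.single b 1)) (starWord d u v)
  termination_by u v => u.length + v.length

/-- The generalised quasi-shuffle product `⋆` on `k⟨Z⟩`, the bilinear extension of
`starWord`. -/
noncomputable def star (d : (Z →₀ k) →ₗ[k] (Z →₀ k) →ₗ[k] (Z →₀ k)) :
    NCPoly k Z →ₗ[k] NCPoly k Z →ₗ[k] NCPoly k Z :=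
  wordLift fun u => wordLift fun v => starWord d u v

theorem wordLift_word {M : Type*} [AddCommGroup M] [Module k M] (f : List Z → M) (w : List Z) :
    wordLift f (word k w) = f w := by
  simp [wordLift, word]

theorem star_word (d : (Z →₀ k) →ₗ[k] (Z →₀ k) →ₗ[k] (Z →₀ k)) (u v : List Z) :
    star d (word k u) (word k v) = starWord d u v := by
  rw [star, wordLift_word, wordLift_word]

theorem letters_single (z : Z) : letters (Finsupp.single z (1 : k)) = word k [z] := by
  simp [letters]

theorem L_nil (d : (Z →₀ k) →ₗ[k] (Z →₀ k) →ₗ[k] (Z →₀ k)) (c : Z →₀ k) :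
    L d c (word k []) = 0 := by
  rw [L, wordLift_word]

theorem L_cons (d : (Z →₀ k) →ₗ[k] (Z →₀ k) →ₗ[k] (Z →₀ k)) (c : Z →₀ k) (x : Z)
    (w : List Z) :
    L d c (word k (x :: w)) = letters (d c (Finsupp.single x 1)) * word k w := by
  rw [L, wordLift_word]

theorem star_nil_left (d : (Z →₀ k) →ₗ[k] (Z →₀ k) →ₗ[k] (Z →₀ k)) (w : List Z) :
    star d (word k []) (word k w) = word k w := by
  rw [star_word, starWord]

theorem star_nil_right (d : (Z →₀ k) →ₗ[k] (Z →₀ k) →ₗ[k] (Z →₀ k)) (w : List Z) :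
    star d (word k w) (word k []) = word k w := by
  cases w <;> rw [star_word, starWord]

theorem star_cons_cons (d : (Z →₀ k) →ₗ[k] (Z →₀ k) →ₗ[k] (Z →₀ k)) (a b : Z)
    (u v : List Z) :
    star d (word k (a :: u)) (word k (b :: v)) =
      word k [a] * star d (word k u) (word k (b :: v))
        + word k [b] * star d (word k (a :: u)) (word k v)
        - L d (d (Finsupp.single a 1) (Finsupp.single b 1)) (star d (word k u) (word k v)) := by
  simp only [star_word]
  rw [starWord]

end

/-- A word is Lyndon if it is non-empty and lexicographically strictly smaller than each of its
non-empty proper right factors. -/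
def IsLyndon {Z : Type*} [LinearOrder Z] (w : List Z) : Prop :=
  w ≠ [] ∧ ∀ u v : List Z, w = u ++ v → u ≠ [] → v ≠ [] → w < v

end GenQuasiShuffle

/-! The product `⋆` is commutative and associative, so evaluation sends the polynomial ring on
Lyndon words to `(k⟨Z⟩, ⋆)`. Bijectivity is a triangularity argument between the monomials and the
words.

By the Chen–Fox–Lyndon theorem (`exists_isLyndonSeq_flatten_eq`, `IsLyndonSeq.eq_of_flatten_eq`),
concatenating the factors of a monomial in non-increasing order matches monomials with words. Up to
shorter words `⋆` is the shuffle product (`star_word_sub_wordSum_mem`), and the non-increasing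
concatenation `w` is the largest shuffle of its factors (`IsLyndonSeq.shuffle_le`). So the monomial
of `w` maps to a positive integer multiple of `w`, plus smaller rearrangements of `w`, plus shorter
words. In characteristic zero the multiple is invertible. As `w` has finitely many rearrangements,
elimination terminates although `Z` need not be well ordered (`bijective_of_hasLeadingWord`). -/

namespace GenQuasiShuffle

/-! ### Lexicographic order and concatenation. -/

section Lex
variable {Z : Type*} [LinearOrder Z]

theorem cons_le_cons_iff' {a b : Z} {u v : List Z} :
    a :: u ≤ b :: v ↔ a < b ∨ a = b ∧ u ≤ v := by
  simp only [le_iff_lt_or_eq, List.cons_lt_cons_iff, List.cons.injEq]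
  tauto

theorem nil_le' (u : List Z) : [] ≤ u := by
  cases u with
  | nil => exact le_rfl
  | cons a u => exact (List.nil_lt_cons a u).le

theorem append_le_append_left_iff (p : List Z) {u v : List Z} : p ++ u ≤ p ++ v ↔ u ≤ v := by
  induction p with
  | nil => rfl
  | cons a p ih => simp [cons_le_cons_iff', ih]

theorem append_lt_append_left_iff (p : List Z) {u v : List Z} : p ++ u < p ++ v ↔ u < v := by
  simp only [← not_le, append_le_append_left_iff]

theorem le_append_right' (u v : List Z) : u ≤ u ++ v := by
  simpa using (append_le_append_left_iff u (u := []) (v := v)).2 (nil_le' v)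

/-- A word larger than `u` either has `u` as a proper prefix or exceeds every extension of `u`. -/
theorem prefix_or_append_lt_of_lt {u v : List Z} (h : u < v) :
    (∃ t, t ≠ [] ∧ v = u ++ t) ∨ ∀ x y, u ++ x < v ++ y := by
  induction u generalizing v with
  | nil => exact Or.inl ⟨v, by rintro rfl; exact lt_irrefl _ h, rfl⟩
  | cons a u ih =>
    cases v with
    | nil => exact absurd h (not_lt.2 (nil_le' _))
    | cons b v =>
      rcases List.cons_lt_cons_iff.1 h with hab | ⟨rfl, huv⟩
      · exact Or.inr fun x y => List.cons_lt_cons_iff.2 (Or.inl hab)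
      · rcases ih huv with ⟨t, ht, rfl⟩ | h'
        · exact Or.inl ⟨t, ht, rfl⟩
        · exact Or.inr fun x y => List.cons_lt_cons_iff.2 (Or.inr ⟨rfl, h' x y⟩)

theorem append_lt_append_of_lt_of_length_le {u v : List Z} (h : u < v) (hl : v.length ≤ u.length)
    (x y : List Z) : u ++ x < v ++ y := by
  rcases prefix_or_append_lt_of_lt h with ⟨t, ht, rfl⟩ | h'
  · have := List.length_pos_iff.2 ht
    rw [List.length_append] at hl
    omega
  · exact h' x y

end Lex

/-! ### Shuffles of words and their largest elements. -/

section Shuffle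
variable {Z : Type*}

/-- The list of all shuffles of two words, with multiplicities. -/
def shuffles : List Z → List Z → List (List Z)
  | [], v => [v]
  | a :: u, [] => [a :: u]
  | a :: u, b :: v =>
      (shuffles u (b :: v)).map (a :: ·) ++ (shuffles (a :: u) v).map (b :: ·)
  termination_by u v => u.length + v.length

@[simp] theorem shuffles_nil_left (v : List Z) : shuffles [] v = [v] := by rw [shuffles]

@[simp] theorem shuffles_nil_right (u : List Z) : shuffles u [] = [u] := by
  cases u <;> rw [shuffles]

theorem shuffles_cons_cons (a b : Z) (u v : List Z) : shuffles (a :: u) (b :: v) =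
    (shuffles u (b :: v)).map (a :: ·) ++ (shuffles (a :: u) v).map (b :: ·) := by
  rw [shuffles]

theorem cons_mem_shuffles_left {u v z : List Z} (a : Z) (h : z ∈ shuffles u v) :
    a :: z ∈ shuffles (a :: u) v := by
  cases v with
  | nil => simp_all
  | cons b v => simp [shuffles_cons_cons, h]

theorem cons_mem_shuffles_right {u v z : List Z} (a : Z) (h : z ∈ shuffles u v) :
    a :: z ∈ shuffles u (a :: v) := by
  cases u with
  | nil => simp_all
  | cons b u => simp [shuffles_cons_cons, h]

theorem mem_shuffles_cases {u v z : List Z} (h : z ∈ shuffles u v) :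
    (z = [] ∧ u = [] ∧ v = []) ∨
    (∃ a u' z', u = a :: u' ∧ z = a :: z' ∧ z' ∈ shuffles u' v) ∨
    (∃ b v' z', v = b :: v' ∧ z = b :: z' ∧ z' ∈ shuffles u v') := by
  cases u with
  | nil =>
    cases v with
    | nil => simp_all
    | cons b v => simp_all
  | cons a u =>
    cases v with
    | nil => simp_all
    | cons b v =>
      rw [shuffles_cons_cons, List.mem_append, List.mem_map, List.mem_map] at h
      rcases h with ⟨z', h, rfl⟩ | ⟨z', h, rfl⟩
      · exact Or.inr (Or.inl ⟨a, u, z', rfl, rfl, h⟩)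
      · exact Or.inr (Or.inr ⟨b, v, z', rfl, rfl, h⟩)

theorem append_mem_shuffles (u v : List Z) : u ++ v ∈ shuffles u v := by
  induction u with
  | nil => simp
  | cons a u ih => exact cons_mem_shuffles_left a ih

theorem append_mem_shuffles' (u v : List Z) : v ++ u ∈ shuffles u v := by
  induction v with
  | nil => simp
  | cons a u ih => exact cons_mem_shuffles_right a ih

theorem mem_shuffles_comm {u v z : List Z} (h : z ∈ shuffles u v) : z ∈ shuffles v u := by
  induction z generalizing u v with
  | nil =>
    rcases mem_shuffles_cases h with ⟨-, rfl, rfl⟩ | ⟨a, u', z', rfl, hz, h⟩ | ⟨a, u', z', rfl, hz, h⟩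
    · simp
    · cases hz
    · cases hz
  | cons c z ih =>
    rcases mem_shuffles_cases h with ⟨hz, -⟩ | ⟨a, u', z', rfl, hz, h⟩ | ⟨a, u', z', rfl, hz, h⟩
    · cases hz
    · cases hz
      exact cons_mem_shuffles_right _ (ih h)
    · cases hz
      exact cons_mem_shuffles_left _ (ih h)

theorem perm_of_mem_shuffles {u v z : List Z} (h : z ∈ shuffles u v) : z.Perm (u ++ v) := by
  induction z generalizing u v with
  | nil =>
    rcases mem_shuffles_cases h with ⟨-, rfl, rfl⟩ | ⟨a, u', z', rfl, hz, h⟩ | ⟨a, u', z', rfl, hz, h⟩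
    · simp
    · cases hz
    · cases hz
  | cons c z ih =>
    rcases mem_shuffles_cases h with ⟨hz, -⟩ | ⟨a, u', z', rfl, hz, h⟩ | ⟨a, u', z', rfl, hz, h⟩
    · cases hz
    · cases hz
      exact (ih h).cons _
    · cases hz
      exact ((ih h).cons _).trans List.perm_middle.symm

variable [LinearOrder Z]

/-- Moving a common prefix from the larger word to the smaller one does not decrease the
largest shuffle. -/
theorem exists_shuffle_move_prefix {z : List Z} : ∀ {p u v : List Z}, v ≤ u →
    z ∈ shuffles (p ++ u) v → ∃ z' ∈ shuffles u (p ++ v), z ≤ z' := by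
  induction z with
  | nil =>
    intro p u v hvu h
    exact ⟨_, append_mem_shuffles _ _, nil_le' _⟩
  | cons c z ih =>
    intro p u v hvu h
    cases p with
    | nil => exact ⟨_, h, le_rfl⟩
    | cons d p =>
      rcases mem_shuffles_cases h with ⟨hz, -⟩ | ⟨a, u', z', hu, hz, h⟩ | ⟨a, v', z', rfl, hz, h⟩
      · cases hz
      · cases hz
        cases hu
        obtain ⟨z', hz', hle⟩ := ih hvu h
        exact ⟨c :: z', cons_mem_shuffles_right _ hz', cons_le_cons_iff'.2 (Or.inr ⟨rfl, hle⟩)⟩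
      · cases hz
        cases u with
        | nil => exact absurd hvu (not_le.2 (List.nil_lt_cons _ _))
        | cons x u =>
          rcases cons_le_cons_iff'.1 hvu with hlt | ⟨rfl, hle⟩
          · exact ⟨_, append_mem_shuffles _ _, cons_le_cons_iff'.2 (Or.inl hlt)⟩
          -- Equal heads: the `c` taken from `v` is charged to `u` instead, so the prefix to be
          -- moved grows by `c`.
          · obtain ⟨z', hz', hle⟩ := ih (p := d :: p ++ [c]) hle (by simpa using h)
            exact ⟨c :: z', cons_mem_shuffles_left _ (by simpa using hz'),
              cons_le_cons_iff'.2 (Or.inr ⟨rfl, hle⟩)⟩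

/-- Taking the head of the larger word first is optimal. A head of `v` taken instead is either
smaller than `a`, or equal to it, and then `exists_shuffle_move_prefix` exchanges the two. -/
theorem exists_shuffle_cons_of_le {a : Z} {u v z : List Z} (h : v ≤ a :: u)
    (hz : z ∈ shuffles (a :: u) v) : ∃ z' ∈ shuffles u v, z ≤ a :: z' := by
  rcases mem_shuffles_cases hz with ⟨-, hu, -⟩ | ⟨a', u', z', hu, rfl, hz'⟩ | ⟨b, v', z', rfl, rfl, hz'⟩
  · cases hu
  · cases hu
    exact ⟨z', hz', le_rfl⟩
  · rcases cons_le_cons_iff'.1 h with hlt | ⟨rfl, hle⟩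
    · exact ⟨_, append_mem_shuffles _ _, cons_le_cons_iff'.2 (Or.inl hlt)⟩
    · obtain ⟨z', hz', hle⟩ := exists_shuffle_move_prefix (p := [b]) hle hz'
      exact ⟨z', hz', cons_le_cons_iff'.2 (Or.inr ⟨rfl, hle⟩)⟩

/-- The hypothesis keeps `v` below what remains of `x ++ y` as long as `x` is not used up, so the
letters of `x` can be taken greedily one by one. -/
theorem exists_shuffle_append_of_le {x y v z : List Z}
    (h : ∀ p s, x = p ++ s → s ≠ [] → v ≤ s ++ y)
    (hz : z ∈ shuffles (x ++ y) v) : ∃ z' ∈ shuffles y v, z ≤ x ++ z' := by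
  induction x generalizing z with
  | nil => exact ⟨z, hz, le_rfl⟩
  | cons a x ih =>
    obtain ⟨z₁, hz₁, hle₁⟩ := exists_shuffle_cons_of_le (h [] (a :: x) rfl (by simp)) hz
    obtain ⟨z', hz', hle⟩ := ih (fun p s hx hs => h (a :: p) s (by simp [hx]) hs) hz₁
    exact ⟨z', hz', hle₁.trans (cons_le_cons_iff'.2 (Or.inr ⟨rfl, hle⟩))⟩

theorem exists_shuffle_mono_right {u v w z : List Z} (h : v ≤ w) (hl : v.length = w.length)
    (hz : z ∈ shuffles u v) : ∃ z' ∈ shuffles u w, z ≤ z' := by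
  induction z generalizing u v w with
  | nil => exact ⟨_, append_mem_shuffles _ _, nil_le' _⟩
  | cons c z ih =>
    rcases mem_shuffles_cases hz with ⟨hz, -⟩ | ⟨a, u', z', rfl, hz, hz'⟩ | ⟨a, v', z', rfl, hz, hz'⟩
    · cases hz
    · cases hz
      obtain ⟨z', hz', hle⟩ := ih h hl hz'
      exact ⟨c :: z', cons_mem_shuffles_left _ hz', cons_le_cons_iff'.2 (Or.inr ⟨rfl, hle⟩)⟩
    · cases hz
      cases w with
      | nil => simp at hl
      | cons b w =>
        rcases cons_le_cons_iff'.1 h with hlt | ⟨rfl, hle⟩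
        · exact ⟨_, append_mem_shuffles' _ _, cons_le_cons_iff'.2 (Or.inl hlt)⟩
        · obtain ⟨z', hz', hle⟩ := ih hle (by simpa using hl) hz'
          exact ⟨c :: z', cons_mem_shuffles_right _ hz',
            cons_le_cons_iff'.2 (Or.inr ⟨rfl, hle⟩)⟩

end Shuffle

/-! ### Lyndon words and the Chen–Fox–Lyndon factorisation. -/

section Lyndon
variable {Z : Type*} [LinearOrder Z]

theorem IsLyndon.le_suffix {l p s : List Z} (hl : IsLyndon l) (h : l = p ++ s) (hs : s ≠ []) :
    l ≤ s := by
  cases p with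
  | nil => simp [h]
  | cons a p => exact (hl.2 _ _ h (by simp) hs).le

theorem isLyndon_singleton (a : Z) : IsLyndon [a] := by
  refine ⟨by simp, fun u v h hu hv => ?_⟩
  have := congrArg List.length h
  have h1 := List.length_pos_iff.2 hu
  have h2 := List.length_pos_iff.2 hv
  simp at this
  omega

theorem IsLyndon.append_lt_right {l m : List Z} (hl : IsLyndon l) (hm : IsLyndon m) (h : l < m) :
    l ++ m < m := by
  rcases prefix_or_append_lt_of_lt h with ⟨t, ht, rfl⟩ | h'
  · rw [append_lt_append_left_iff]
    exact hm.2 _ _ rfl hl.1 ht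
  · simpa using h' m []

/-- A suffix inside `m` is at least `m`, which exceeds `l ++ m`. A longer one starts with a proper
suffix of `l`, which is larger than `l` and shorter, so the comparison is decided before `m` is
reached. -/
theorem IsLyndon.append {l m : List Z} (hl : IsLyndon l) (hm : IsLyndon m) (h : l < m) :
    IsLyndon (l ++ m) := by
  refine ⟨by simp [hl.1], fun u v huv hu hv => ?_⟩
  rcases List.append_eq_append_iff.1 huv with ⟨t, rfl, ht⟩ | ⟨t, rfl, rfl⟩
  · exact (hl.append_lt_right hm h).trans_le (hm.le_suffix ht hv)
  · by_cases ht : t = []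
    · subst ht
      simpa using hl.append_lt_right hm h
    · exact append_lt_append_of_lt_of_length_le (hl.2 _ _ rfl hu ht) (by simp) _ _

/-- Non-increasing sequences of Lyndon words. -/
def IsLyndonSeq (ls : List (List Z)) : Prop :=
  (∀ l ∈ ls, IsLyndon l) ∧ ls.Pairwise (· ≥ ·)

theorem isLyndonSeq_cons {l : List Z} {ls : List (List Z)} :
    IsLyndonSeq (l :: ls) ↔ IsLyndon l ∧ (∀ m ∈ ls, m ≤ l) ∧ IsLyndonSeq ls := by
  simp [IsLyndonSeq, and_assoc, and_left_comm]

/-- If `l` is smaller than the first term, it absorbs that term into a longer Lyndon word; otherwise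
it can simply be prepended. -/
theorem exists_isLyndonSeq_append {l : List Z} {ls : List (List Z)} (hl : IsLyndon l)
    (hls : IsLyndonSeq ls) : ∃ ms, IsLyndonSeq ms ∧ ms.flatten = l ++ ls.flatten := by
  induction ls generalizing l with
  | nil => exact ⟨[l], by simpa [IsLyndonSeq] using hl, by simp⟩
  | cons m ls ih =>
    obtain ⟨hm, hle, hls'⟩ := isLyndonSeq_cons.1 hls
    rcases lt_or_ge l m with h | h
    · obtain ⟨ms, h1, h2⟩ := ih (hl.append hm h) hls'
      exact ⟨ms, h1, by simpa using h2⟩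
    · refine ⟨l :: m :: ls, isLyndonSeq_cons.2 ⟨hl, fun k hk => ?_, hls⟩, by simp⟩
      rcases List.mem_cons.1 hk with rfl | hk
      · exact h
      · exact (hle k hk).trans h

/-- Every word is a concatenation of a non-increasing sequence of Lyndon words. -/
theorem exists_isLyndonSeq_flatten_eq (w : List Z) : ∃ ls, IsLyndonSeq ls ∧ ls.flatten = w := by
  induction w with
  | nil => exact ⟨[], by simp [IsLyndonSeq], rfl⟩
  | cons a w ih =>
    obtain ⟨ls, hls, rfl⟩ := ih
    exact exists_isLyndonSeq_append (isLyndon_singleton a) hls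

theorem prefix_append_cases {α : Type*} {l m x : List α} (h : l <+: m ++ x) :
    l <+: m ∨ ∃ t, l = m ++ t ∧ t <+: x := by
  obtain ⟨r, hr⟩ := h
  rcases List.append_eq_append_iff.1 hr with ⟨t, rfl, -⟩ | ⟨t, rfl, rfl⟩
  · exact Or.inl (List.prefix_append _ _)
  · exact Or.inr ⟨t, rfl, List.prefix_append _ _⟩

theorem exists_suffix_le_of_prefix_flatten {ls : List (List Z)} {s : List Z} (hs : s ≠ [])
    (h : s <+: ls.flatten) : ∃ p t, s = p ++ t ∧ t ≠ [] ∧ ∃ m ∈ ls, t ≤ m := by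
  induction ls generalizing s with
  | nil => simp_all
  | cons m ls ih =>
    rw [List.flatten_cons] at h
    by_cases hsm : s <+: m
    · obtain ⟨t, rfl⟩ := hsm
      exact ⟨[], s, rfl, hs, _, List.mem_cons_self, le_append_right' _ _⟩
    · rcases prefix_append_cases h with h | ⟨t, rfl, ht⟩
      · exact absurd h hsm
      · by_cases ht0 : t = []
        · subst ht0
          simp at hsm
        · obtain ⟨p, t', rfl, ht', k, hk, hle⟩ := ih ht0 ht
          exact ⟨m ++ p, t', by simp, ht', k, List.mem_cons_of_mem _ hk, hle⟩

/-- If `l` ran past `m`, it would end in a non-empty prefix `t` of a later factor `k`, giving `t ≤ k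
≤ m ≤ l`, whereas a proper suffix of a Lyndon word is larger than the word. -/
theorem IsLyndon.length_le_of_prefix {l m : List Z} {ls : List (List Z)} (hl : IsLyndon l)
    (hm : m ≠ []) (hle : ∀ k ∈ ls, k ≤ m) (h : l <+: m ++ ls.flatten) : l.length ≤ m.length := by
  rcases prefix_append_cases h with h | ⟨s, rfl, hs⟩
  · exact h.length_le
  · by_cases hs0 : s = []
    · simp [hs0]
    · obtain ⟨p, t, rfl, ht, k, hk, htk⟩ := exists_suffix_le_of_prefix_flatten hs0 hs
      have h1 := hl.2 (m ++ p) t (by simp) (by simp [hm]) ht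
      exact absurd (h1.trans_le (htk.trans (hle k hk))) (not_lt.2 (le_append_right' _ _))

/-- The factorisation into a non-increasing sequence of Lyndon words is unique. -/
theorem IsLyndonSeq.eq_of_flatten_eq {ls ms : List (List Z)} (hls : IsLyndonSeq ls)
    (hms : IsLyndonSeq ms) (h : ls.flatten = ms.flatten) : ls = ms := by
  induction ls generalizing ms with
  | nil =>
    cases ms with
    | nil => rfl
    | cons m ms =>
      have := (isLyndonSeq_cons.1 hms).1.1
      simp_all
  | cons l ls ih =>
    obtain ⟨hl, hle, hls'⟩ := isLyndonSeq_cons.1 hls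
    cases ms with
    | nil =>
      have := hl.1
      simp_all
    | cons m ms =>
      obtain ⟨hm, hme, hms'⟩ := isLyndonSeq_cons.1 hms
      rw [List.flatten_cons, List.flatten_cons] at h
      have h1 := hl.length_le_of_prefix hm.1 hme (h ▸ List.prefix_append _ _)
      have h2 := hm.length_le_of_prefix hl.1 hle (h ▸ List.prefix_append _ _)
      obtain ⟨rfl, h3⟩ := List.append_inj h (le_antisymm h1 h2)
      rw [ih hls' hms' h3]

/-- Each factor is below `l`, hence below `s`. Either this decides the comparison, or the factor is
a proper prefix of `s` and can be stripped, leaving a suffix that is again at least `l`. -/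
theorem flatten_le_of_suffixes {ls : List (List Z)} {l s : List Z} (hs : s ≠ [])
    (hsuf : ∀ p t, s = p ++ t → t ≠ [] → l ≤ t) (hlt : ∀ m ∈ ls, m < l) : ls.flatten ≤ s := by
  induction ls generalizing s with
  | nil => exact nil_le' _
  | cons m ls ih =>
    have hms : m < s := (hlt m List.mem_cons_self).trans_le (hsuf [] s rfl hs)
    rw [List.flatten_cons]
    rcases prefix_or_append_lt_of_lt hms with ⟨t, ht, rfl⟩ | h'
    · rw [append_le_append_left_iff]
      exact ih ht (fun p t' h1 h2 => hsuf (m ++ p) t' (by simp [h1]) h2)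
        fun k hk => hlt k (List.mem_cons_of_mem _ hk)
    · simpa using (h' ls.flatten []).le

/-- The concatenation of a non-increasing sequence of Lyndon words is the largest shuffle of its
first term with the concatenation of the others. -/
theorem IsLyndonSeq.shuffle_le {l : List Z} {ls : List (List Z)} (h : IsLyndonSeq (l :: ls))
    {z : List Z} (hz : z ∈ shuffles l ls.flatten) : z ≤ l ++ ls.flatten := by
  induction ls generalizing z with
  | nil => simp_all
  | cons m ls ih =>
    obtain ⟨hl, hle, hls⟩ := isLyndonSeq_cons.1 h
    obtain ⟨hm, hme, hls'⟩ := isLyndonSeq_cons.1 hls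
    -- If the next factor equals `l`, its copy in the concatenation is used up first, and the
    -- induction hypothesis shuffles the other `l` with the rest. If it is smaller, so are all later
    -- factors; every suffix of `l` then dominates their concatenation, and `l` goes first.
    rcases (hle m List.mem_cons_self).eq_or_lt with rfl | hlt
    · rw [List.flatten_cons] at hz ⊢
      obtain ⟨z', hz', hzz⟩ := exists_shuffle_append_of_le
        (fun p s hp hs => (hm.le_suffix hp hs).trans (le_append_right' _ _)) (mem_shuffles_comm hz)
      exact hzz.trans ((append_le_append_left_iff _).2 (ih hls (mem_shuffles_comm hz')))
    · have hlt' : ∀ k ∈ m :: ls, k < l := by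
        intro k hk
        rcases List.mem_cons.1 hk with rfl | hk
        · exact hlt
        · exact (hme k hk).trans_lt hlt
      obtain ⟨z', hz', hzz⟩ := exists_shuffle_append_of_le (x := l) (y := []) (z := z)
        (v := (m :: ls).flatten)
        (fun p s hp hs => by
          rw [List.append_nil]
          exact flatten_le_of_suffixes hs
            (fun q t hq ht => hl.le_suffix (p := p ++ q) (by simp [hp, hq]) ht) hlt')
        (by simpa using hz)
      rw [shuffles_nil_left, List.mem_singleton] at hz'
      rwa [hz'] at hzz

end Lyndon
-- Commutativity and associativity of `⋆`.
section Algebra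
variable {k Z : Type*} [Field k]

theorem word_cons (a : Z) (w : List Z) : word k (a :: w) = word k [a] * word k w := by
  rw [word, word, word, ← map_mul]
  rfl

theorem word_induction {p : NCPoly k Z → Prop} (hw : ∀ w, p (word k w))
    (ha : ∀ x y, p x → p y → p (x + y)) (hs : ∀ (c : k) x, p x → p (c • x)) (x : NCPoly k Z) :
    p x := by
  refine MonoidAlgebra.induction_on x (fun m => hw m.toList) ha hs

variable {d : (Z →₀ k) →ₗ[k] (Z →₀ k) →ₗ[k] (Z →₀ k)}

theorem star_one_left (x : NCPoly k Z) : star d (word k []) x = x := by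
  induction x using word_induction with
  | hw w => exact star_nil_left d w
  | ha x y hx hy => rw [map_add, hx, hy]
  | hs c x hx => rw [map_smul, hx]

theorem star_one_right (x : NCPoly k Z) : star d x (word k []) = x := by
  induction x using word_induction with
  | hw w => exact star_nil_right d w
  | ha x y hx hy => rw [map_add, LinearMap.add_apply, hx, hy]
  | hs c x hx => rw [map_smul, LinearMap.smul_apply, hx]

theorem L_letters_mul (e x : Z →₀ k) (u : NCPoly k Z) :
    L d e (letters x * u) = letters (d e x) * u := by
  induction x using Finsupp.induction_linear with
  | zero => simp
  | add x y hx hy => simp only [map_add, add_mul, hx, hy]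
  | single z c =>
    rw [← Finsupp.smul_single_one z c]
    simp only [map_smul, smul_mul_assoc, letters_single]
    congr 1
    induction u using word_induction with
    | hw w => rw [← word_cons, L_cons]
    | ha x y hx hy => simp only [map_add, mul_add, hx, hy]
    | hs c x hx => simp only [map_smul, mul_smul_comm, hx]

theorem L_add (e f : Z →₀ k) (u : NCPoly k Z) : L d (e + f) u = L d e u + L d f u := by
  induction u using word_induction with
  | hw w => cases w <;> simp [L_nil, L_cons, add_mul]
  | ha x y hx hy => simp only [map_add, hx, hy]; abel
  | hs c x hx => simp only [map_smul, hx, smul_add]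

theorem L_smul (c : k) (e : Z →₀ k) (u : NCPoly k Z) : L d (c • e) u = c • L d e u := by
  induction u using word_induction with
  | hw w => cases w <;> simp [L_nil, L_cons]
  | ha x y hx hy => simp only [map_add, hx, hy, smul_add]
  | hs c x hx => simp only [map_smul, hx]; rw [smul_comm]

theorem L_zero (u : NCPoly k Z) : L d 0 u = 0 := by
  simpa using L_smul (d := d) 0 0 u

/-- The bilinear form of the recursion is needed because `L` turns a leading letter into a
combination of letters. -/
theorem star_letters_mul (x y : Z →₀ k) (u v : NCPoly k Z) :
    star d (letters x * u) (letters y * v) = letters x * star d u (letters y * v)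
      + letters y * star d (letters x * u) v - L d (d x y) (star d u v) := by
  induction x using Finsupp.induction_linear with
  | zero => simp [L_zero]
  | add x x' hx hy =>
    simp only [map_add, add_mul, mul_add, LinearMap.add_apply, hx, hy, L_add]; abel
  | single a c =>
  rw [← Finsupp.smul_single_one a c]
  simp only [map_smul, smul_mul_assoc, mul_smul_comm, letters_single, LinearMap.smul_apply, L_smul,
    ← smul_add, ← smul_sub]
  congr 1
  induction y using Finsupp.induction_linear with
  | zero => simp [L_zero]
  | add x x' hx hy =>
    simp only [map_add, add_mul, mul_add, hx, hy, L_add]; abel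
  | single b c =>
  rw [← Finsupp.smul_single_one b c]
  simp only [map_smul, smul_mul_assoc, mul_smul_comm, letters_single, L_smul,
    ← smul_add, ← smul_sub]
  congr 1
  induction u using word_induction with
  | ha x x' hx hy =>
    simp only [map_add, mul_add, LinearMap.add_apply, hx, hy]; abel
  | hs c x hx => simp only [map_smul, mul_smul_comm, LinearMap.smul_apply, hx, smul_sub, smul_add]
  | hw u =>
  induction v using word_induction with
  | ha x x' hx hy =>
    simp only [map_add, mul_add, hx, hy]; abel
  | hs c x hx => simp only [map_smul, mul_smul_comm, hx, smul_sub, smul_add]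
  | hw v => simp only [← word_cons, star_cons_cons]

theorem star_word_comm (d_comm : ∀ x y : Z →₀ k, d x y = d y x) (n : ℕ) : ∀ u v : List Z,
    u.length + v.length ≤ n → star d (word k u) (word k v) = star d (word k v) (word k u) := by
  induction n with
  | zero =>
    intro u v h
    obtain rfl : u = [] := List.length_eq_zero_iff.1 (by omega)
    rw [star_one_left, star_one_right]
  | succ n ih =>
    intro u v h
    cases u with
    | nil => rw [star_one_left, star_one_right]
    | cons a u =>
      cases v with
      | nil => rw [star_one_left, star_one_right]
      | cons b v =>
        simp only [List.length_cons] at h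
        rw [star_cons_cons, star_cons_cons, ih u (b :: v) (by simp; omega),
          ih (a :: u) v (by simp; omega), ih u v (by omega), d_comm (Finsupp.single a 1)]
        abel

theorem star_comm (d_comm : ∀ x y : Z →₀ k, d x y = d y x) (x y : NCPoly k Z) :
    star d x y = star d y x := by
  induction x using word_induction with
  | ha x x' hx hx' => simp only [map_add, LinearMap.add_apply, hx, hx']
  | hs c x hx => simp only [map_smul, LinearMap.smul_apply, hx]
  | hw u =>
    induction y using word_induction with
    | ha x x' hx hx' => simp only [map_add, LinearMap.add_apply, hx, hx']
    | hs c x hx => simp only [map_smul, LinearMap.smul_apply, hx]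
    | hw v => exact star_word_comm d_comm _ u v le_rfl

theorem L_L (d_assoc : ∀ x y z : Z →₀ k, d (d x y) z = d x (d y z)) (e f : Z →₀ k)
    (x : NCPoly k Z) : L d e (L d f x) = L d (d e f) x := by
  induction x using word_induction with
  | ha x x' hx hx' => simp only [map_add, hx, hx']
  | hs c x hx => simp only [map_smul, hx]
  | hw u =>
    cases u with
    | nil => simp [L_nil]
    | cons a u => rw [L_cons, L_cons, L_letters_mul, d_assoc]

theorem star_L_letters_mul (d_assoc : ∀ x y z : Z →₀ k, d (d x y) z = d x (d y z)) (e c : Z →₀ k)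
    (x w : NCPoly k Z) : star d (L d e x) (letters c * w) =
      L d e (star d x (letters c * w)) - letters (d e c) * star d x w
        + letters c * star d (L d e x) w := by
  induction x using word_induction with
  | ha x x' hx hx' => simp only [map_add, LinearMap.add_apply, mul_add, hx, hx']; abel
  | hs r x hx =>
    simp only [map_smul, LinearMap.smul_apply, hx, mul_smul_comm, smul_sub, smul_add]
  | hw u =>
    cases u with
    | nil => simp [L_nil, star_one_left, L_letters_mul]
    | cons a u =>
      rw [L_cons, star_letters_mul, word_cons, ← letters_single a, star_letters_mul, map_sub,
        map_add, L_letters_mul, L_letters_mul, L_L d_assoc, d_assoc]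
      abel

/-- The expansion is arranged so that rotating the three factors permutes its terms, given
commutativity of `d` and the same invariance for the smaller triple products. -/
theorem star_star_letters_mul (d_assoc : ∀ x y z : Z →₀ k, d (d x y) z = d x (d y z))
    (a b c : Z →₀ k) (u v w : NCPoly k Z) :
    star d (star d (letters a * u) (letters b * v)) (letters c * w) =
      letters a * star d (star d u (letters b * v)) (letters c * w)
        + letters b * star d (star d (letters a * u) v) (letters c * w)
        + letters c * star d (star d (letters a * u) (letters b * v)) w
        - L d (d a c) (star d (star d u (letters b * v)) w)
        - L d (d b c) (star d (star d (letters a * u) v) w)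
        - L d (d a b) (star d (star d u v) (letters c * w))
        + letters (d (d a b) c) * star d (star d u v) w := by
  rw [star_letters_mul a b]
  simp only [map_add, map_sub, LinearMap.add_apply, LinearMap.sub_apply, mul_add, mul_sub,
    star_letters_mul _ c, star_L_letters_mul d_assoc]
  abel

/-- Given commutativity, associativity amounts to invariance under rotation, and in this form one
expansion formula serves both sides. -/
theorem star_word_cyclic (d_comm : ∀ x y : Z →₀ k, d x y = d y x)
    (d_assoc : ∀ x y z : Z →₀ k, d (d x y) z = d x (d y z)) (n : ℕ) : ∀ u v w : List Z,
    u.length + v.length + w.length ≤ n →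
      star d (star d (word k u) (word k v)) (word k w) =
        star d (star d (word k v) (word k w)) (word k u) := by
  induction n with
  | zero =>
    intro u v w h
    obtain rfl : u = [] := List.length_eq_zero_iff.1 (by omega)
    rw [star_one_left, star_one_right]
  | succ n ih =>
    intro u v w h
    cases u with
    | nil => rw [star_one_left, star_one_right]
    | cons a u =>
    cases v with
    | nil => rw [star_one_left, star_one_right, star_comm d_comm]
    | cons b v =>
    cases w with
    | nil => rw [star_one_right, star_one_right, star_comm d_comm]
    | cons c w =>
      simp only [List.length_cons] at h
      have h1 := ih u (b :: v) (c :: w) (by simp; omega)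
      have h2 := ih (a :: u) v (c :: w) (by simp; omega)
      have h3 := ih (a :: u) (b :: v) w (by simp; omega)
      have h4 := ih u (b :: v) w (by simp; omega)
      have h5 := ih (a :: u) v w (by simp; omega)
      have h6 := ih u v (c :: w) (by simp; omega)
      have h7 := ih u v w (by omega)
      simp only [word_cons a u, word_cons b v, word_cons c w, ← letters_single] at h1 h2 h3 h4 h5 h6 ⊢
      rw [star_star_letters_mul d_assoc, star_star_letters_mul d_assoc, h1, h2, h3, h4, h5, h6, h7,
        d_comm (Finsupp.single b 1) (Finsupp.single a 1),
        d_comm (Finsupp.single c 1) (Finsupp.single a 1), d_assoc,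
        d_comm (Finsupp.single a 1) (d (Finsupp.single b 1) (Finsupp.single c 1))]
      abel

theorem star_assoc (d_comm : ∀ x y : Z →₀ k, d x y = d y x)
    (d_assoc : ∀ x y z : Z →₀ k, d (d x y) z = d x (d y z)) (x y z : NCPoly k Z) :
    star d (star d x y) z = star d x (star d y z) := by
  rw [star_comm d_comm x (star d y z)]
  induction x using word_induction with
  | ha x x' hx hx' => simp only [map_add, LinearMap.add_apply, hx, hx']
  | hs c x hx => simp only [map_smul, LinearMap.smul_apply, hx]
  | hw u =>
  induction y using word_induction with
  | ha x x' hx hx' => simp only [map_add, LinearMap.add_apply, hx, hx']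
  | hs c x hx => simp only [map_smul, LinearMap.smul_apply, hx]
  | hw v =>
  induction z using word_induction with
  | ha x x' hx hx' => simp only [map_add, LinearMap.add_apply, hx, hx']
  | hs c x hx => simp only [map_smul, LinearMap.smul_apply, hx]
  | hw w => exact star_word_cyclic d_comm d_assoc _ u v w le_rfl

/-- The space `k⟨Z⟩`, to be endowed with the product `⋆` instead of concatenation. -/
def StarAlgebra (_ : (Z →₀ k) →ₗ[k] (Z →₀ k) →ₗ[k] (Z →₀ k)) : Type _ := NCPoly k Z

noncomputable instance : AddCommGroup (StarAlgebra d) := inferInstanceAs (AddCommGroup (NCPoly k Z))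

noncomputable instance : Module k (StarAlgebra d) := inferInstanceAs (Module k (NCPoly k Z))

/-- The commutative ring structure given by `⋆`. -/
noncomputable abbrev starCommRing (d_comm : ∀ x y : Z →₀ k, d x y = d y x)
    (d_assoc : ∀ x y z : Z →₀ k, d (d x y) z = d x (d y z)) : CommRing (StarAlgebra d) :=
  { (inferInstance : AddCommGroup (StarAlgebra d)) with
    mul := fun x y => star d x y
    one := word k []
    mul_assoc := star_assoc d_comm d_assoc
    mul_comm := star_comm d_comm
    one_mul := star_one_left
    mul_one := star_one_right
    zero_mul := fun x => LinearMap.map_zero₂ (star d) x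
    mul_zero := fun x => map_zero (star d x)
    left_distrib := fun x y z => map_add (star d x) y z
    right_distrib := fun x y z => LinearMap.map_add₂ (star d) x y z }

/-- For a commutative and associative `d`, there is an algebra homomorphism from a polynomial ring
to `(k⟨Z⟩, ⋆)` with prescribed images of the variables. -/
theorem exists_linearMap_star (d_comm : ∀ x y : Z →₀ k, d x y = d y x)
    (d_assoc : ∀ x y z : Z →₀ k, d (d x y) z = d x (d y z)) {σ : Type*} (f : σ → NCPoly k Z) :
    ∃ e : MvPolynomial σ k →ₗ[k] NCPoly k Z, e 1 = word k [] ∧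
      (∀ p q, e (p * q) = star d (e p) (e q)) ∧ ∀ i, e (MvPolynomial.X i) = f i := by
  let := starCommRing d_comm d_assoc
  let : Algebra k (StarAlgebra d) := Algebra.ofModule
    (fun r x y => LinearMap.map_smul₂ (star d) r x y)
    (fun r x y => map_smul (star d x) r y)
  let φ : MvPolynomial σ k →ₐ[k] StarAlgebra d := MvPolynomial.aeval (S₁ := StarAlgebra d) f
  exact ⟨φ.toLinearMap, map_one φ, map_mul φ, fun i => MvPolynomial.aeval_X (S₁ := StarAlgebra d) f i⟩

end Algebra
-- Comparison of `⋆` with the shuffle product modulo shorter words.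
section Filtration
variable {k Z : Type*} [Field k]

/-- The span of the words of length less than `n`. -/
noncomputable def lengthFiltration (k Z : Type*) [Field k] (n : ℕ) : Submodule k (NCPoly k Z) :=
  Submodule.span k (word k '' {v | v.length < n})

theorem word_mem_lengthFiltration {v : List Z} {n : ℕ} (h : v.length < n) :
    word k v ∈ lengthFiltration k Z n :=
  Submodule.subset_span ⟨v, h, rfl⟩

theorem lengthFiltration_mono {m n : ℕ} (h : m ≤ n) :
    lengthFiltration k Z m ≤ lengthFiltration k Z n :=
  Submodule.span_mono (Set.image_mono fun _ hv => lt_of_lt_of_le hv h)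

theorem map_mem_of_mem_lengthFiltration {M : Type*} [AddCommGroup M] [Module k M]
    (f : NCPoly k Z →ₗ[k] M) (N : Submodule k M) {n : ℕ}
    (h : ∀ v : List Z, v.length < n → f (word k v) ∈ N) {x : NCPoly k Z}
    (hx : x ∈ lengthFiltration k Z n) : f x ∈ N := by
  have : lengthFiltration k Z n ≤ N.comap f := by
    rw [lengthFiltration, Submodule.span_le]
    rintro _ ⟨v, hv, rfl⟩
    exact h v hv
  exact this hx

theorem word_singleton_mul_mem {n : ℕ} (a : Z) {x : NCPoly k Z} (hx : x ∈ lengthFiltration k Z n) :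
    word k [a] * x ∈ lengthFiltration k Z (n + 1) :=
  map_mem_of_mem_lengthFiltration (LinearMap.mulLeft k (word k [a])) _ (fun v hv => by
    rw [LinearMap.mulLeft_apply, ← word_cons]
    exact word_mem_lengthFiltration (by simpa using hv)) hx

theorem letters_mul_mem {n : ℕ} (c : Z →₀ k) {x : NCPoly k Z} (hx : x ∈ lengthFiltration k Z n) :
    letters c * x ∈ lengthFiltration k Z (n + 1) := by
  induction c using Finsupp.induction_linear with
  | zero => simp
  | add c c' h h' =>
    rw [map_add, add_mul]
    exact add_mem h h'
  | single a r =>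
    rw [← Finsupp.smul_single_one a r, map_smul, letters_single, smul_mul_assoc]
    exact Submodule.smul_mem _ _ (word_singleton_mul_mem a hx)

variable {d : (Z →₀ k) →ₗ[k] (Z →₀ k) →ₗ[k] (Z →₀ k)}

theorem L_mem {n : ℕ} (c : Z →₀ k) {x : NCPoly k Z} (hx : x ∈ lengthFiltration k Z n) :
    L d c x ∈ lengthFiltration k Z n := by
  refine map_mem_of_mem_lengthFiltration (L d c) _ (fun v hv => ?_) hx
  cases v with
  | nil =>
    rw [L_nil]
    exact zero_mem _
  | cons a v =>
    rw [L_cons]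
    exact lengthFiltration_mono (Nat.succ_le_of_lt hv)
      (letters_mul_mem _ (word_mem_lengthFiltration (Nat.lt_succ_self _)))

theorem star_word_mem (n : ℕ) : ∀ u v : List Z, u.length + v.length < n →
    star d (word k u) (word k v) ∈ lengthFiltration k Z n := by
  induction n with
  | zero => simp
  | succ n ih =>
    intro u v h
    cases u with
    | nil =>
      rw [star_one_left]
      exact word_mem_lengthFiltration (by simpa using h)
    | cons a u =>
      cases v with
      | nil =>
        rw [star_one_right]
        exact word_mem_lengthFiltration (by simpa using h)
      | cons b v =>
        simp only [List.length_cons] at h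
        rw [star_cons_cons]
        exact sub_mem (add_mem (word_singleton_mul_mem a (ih _ _ (by simp; omega)))
          (word_singleton_mul_mem b (ih _ _ (by simp; omega))))
          (L_mem _ (lengthFiltration_mono n.le_succ (ih _ _ (by omega))))

theorem star_word_left_mem {m n : ℕ} {u : List Z} (h : u.length ≤ m) {x : NCPoly k Z}
    (hx : x ∈ lengthFiltration k Z n) : star d (word k u) x ∈ lengthFiltration k Z (m + n) :=
  map_mem_of_mem_lengthFiltration (star d (word k u)) _
    (fun v hv => star_word_mem _ _ _ (by omega)) hx

/-- The sum of a list of words. -/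
noncomputable def wordSum (k : Type*) {Z : Type*} [Field k] (s : List (List Z)) : NCPoly k Z :=
  (s.map (word k)).sum

theorem wordSum_append (s t : List (List Z)) : wordSum k (s ++ t) = wordSum k s + wordSum k t := by
  simp [wordSum]

theorem wordSum_cons (v : List Z) (t : List (List Z)) :
    wordSum k (v :: t) = word k v + wordSum k t := by
  simp [wordSum]

theorem wordSum_map_cons (a : Z) (s : List (List Z)) :
    wordSum k (s.map (a :: ·)) = word k [a] * wordSum k s := by
  induction s with
  | nil => simp [wordSum]
  | cons v s ih => rw [List.map_cons, wordSum_cons, wordSum_cons, ih, mul_add, ← word_cons]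

theorem wordSum_mem {N : Submodule k (NCPoly k Z)} {s : List (List Z)}
    (h : ∀ v ∈ s, word k v ∈ N) : wordSum k s ∈ N := by
  refine list_sum_mem fun x hx => ?_
  obtain ⟨v, hv, rfl⟩ := List.mem_map.1 hx
  exact h v hv

/-- Up to shorter words, `⋆` is the shuffle product. -/
theorem star_word_sub_wordSum_mem (n : ℕ) : ∀ u v : List Z, u.length + v.length ≤ n →
    star d (word k u) (word k v) - wordSum k (shuffles u v) ∈ lengthFiltration k Z n := by
  induction n with
  | zero =>
    intro u v h
    obtain rfl : u = [] := List.length_eq_zero_iff.1 (by omega)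
    simp [star_one_left, wordSum]
  | succ n ih =>
    intro u v h
    cases u with
    | nil => simp [star_one_left, wordSum]
    | cons a u =>
      cases v with
      | nil => simp [star_one_right, wordSum]
      | cons b v =>
        simp only [List.length_cons] at h
        rw [star_cons_cons, shuffles_cons_cons, wordSum_append, wordSum_map_cons, wordSum_map_cons,
          sub_right_comm, add_sub_add_comm, ← mul_sub, ← mul_sub]
        exact sub_mem (add_mem (word_singleton_mul_mem a (ih _ _ (by simp; omega)))
          (word_singleton_mul_mem b (ih _ _ (by simp; omega))))
          -- The correction term has lost two letters, and `L` only replaces a first letter, so it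
          -- is of lower order.
          (L_mem _ (star_word_mem _ _ _ (by omega)))

theorem star_wordSum_sub_wordSum_mem {n : ℕ} (u : List Z) (s : List (List Z))
    (h : ∀ v ∈ s, v.length ≤ n) :
    star d (word k u) (wordSum k s) - wordSum k (s.flatMap (shuffles u))
      ∈ lengthFiltration k Z (u.length + n) := by
  induction s with
  | nil => simp [wordSum]
  | cons v s ih =>
    rw [List.flatMap_cons, wordSum_append, wordSum_cons, map_add, add_sub_add_comm]
    exact add_mem (star_word_sub_wordSum_mem _ _ _ (by simpa using h v List.mem_cons_self))
      (ih fun w hw => h w (List.mem_cons_of_mem _ hw))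

end Filtration

/-! ### Leading words and triangularity. -/

section Leading
variable {k Z : Type*} [Field k] [LinearOrder Z]

/-- `x` is, up to words shorter than `w`, a sum of rearrangements of `w`, the largest of which
is `w`. -/
def HasLeadingWord (x : NCPoly k Z) (w : List Z) : Prop :=
  ∃ s : List (List Z), w ∈ s ∧ (∀ v ∈ s, v.Perm w ∧ v ≤ w) ∧
    x - wordSum k s ∈ lengthFiltration k Z w.length

theorem hasLeadingWord_word (w : List Z) : HasLeadingWord (word k w) w :=
  ⟨[w], by simp, by simp, by simp [wordSum]⟩

theorem HasLeadingWord.star {d : (Z →₀ k) →ₗ[k] (Z →₀ k) →ₗ[k] (Z →₀ k)} {l : List Z}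
    {ls : List (List Z)} (h : IsLyndonSeq (l :: ls)) {x : NCPoly k Z}
    (hx : HasLeadingWord x ls.flatten) :
    HasLeadingWord (star d (word k l) x) (l :: ls).flatten := by
  obtain ⟨s, hws, hs, hR⟩ := hx
  refine ⟨s.flatMap (shuffles l), ?_, ?_, ?_⟩
  · exact List.mem_flatMap.2 ⟨_, hws, append_mem_shuffles _ _⟩
  · intro z hz
    obtain ⟨v, hv, hz⟩ := List.mem_flatMap.1 hz
    refine ⟨(perm_of_mem_shuffles hz).trans ((hs v hv).1.append_left l), ?_⟩
    obtain ⟨z', hz', hle⟩ := exists_shuffle_mono_right (hs v hv).2 (hs v hv).1.length_eq hz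
    exact hle.trans (h.shuffle_le hz')
  · rw [List.flatten_cons, List.length_append]
    have h1 := star_wordSum_sub_wordSum_mem (k := k) (d := d) l s fun v hv => (hs v hv).1.length_eq.le
    have h2 := star_word_left_mem (d := d) (le_refl l.length) hR
    rw [map_sub] at h2
    simpa using add_mem h2 h1

/-- The coefficient of a word. -/
noncomputable def wordCoeff (k : Type*) {Z : Type*} [Field k] (w : List Z) : NCPoly k Z →ₗ[k] k :=
  Finsupp.lapply w ∘ₗ wordLift fun v => Finsupp.single v (1 : k)

theorem wordCoeff_word (w v : List Z) : wordCoeff k w (word k v) = if v = w then 1 else 0 := by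
  rw [wordCoeff, LinearMap.comp_apply, wordLift_word, Finsupp.lapply_apply, Finsupp.single_apply]

theorem wordCoeff_wordSum (w : List Z) (s : List (List Z)) :
    wordCoeff k w (wordSum k s) = s.count w := by
  induction s with
  | nil => simp [wordSum]
  | cons v s ih =>
    rw [wordSum_cons, map_add, ih, wordCoeff_word, List.count_cons, add_comm]
    by_cases h : v = w <;> simp [h]

theorem wordCoeff_eq_zero {w : List Z} {n : ℕ} (hn : n ≤ w.length) {x : NCPoly k Z}
    (hx : x ∈ lengthFiltration k Z n) : wordCoeff k w x = 0 := by
  refine (Submodule.mem_bot k).1 (map_mem_of_mem_lengthFiltration (wordCoeff k w) ⊥ (fun v hv => ?_) hx)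
  rw [wordCoeff_word, if_neg, Submodule.mem_bot]
  rintro rfl
  omega

theorem HasLeadingWord.wordCoeff_eq {x : NCPoly k Z} {w v : List Z} (h : HasLeadingWord x w)
    (hl : w.length ≤ v.length) (hv : v.length = w.length → w ≤ v) (hne : v ≠ w) :
    wordCoeff k v x = 0 := by
  obtain ⟨s, hws, hs, hR⟩ := h
  have h1 := wordCoeff_eq_zero hl hR
  rw [map_sub, wordCoeff_wordSum, List.count_eq_zero_of_not_mem, Nat.cast_zero, sub_zero] at h1
  · exact h1
  · intro hvs
    obtain ⟨hp, hle⟩ := hs v hvs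
    exact hne (le_antisymm hle (hv hp.length_eq))

theorem HasLeadingWord.wordCoeff_ne_zero [CharZero k] {x : NCPoly k Z} {w : List Z}
    (h : HasLeadingWord x w) : wordCoeff k w x ≠ 0 := by
  obtain ⟨s, hws, hs, hR⟩ := h
  have h1 := wordCoeff_eq_zero le_rfl hR
  rw [map_sub, wordCoeff_wordSum, sub_eq_zero] at h1
  rw [h1, Nat.cast_ne_zero]
  exact (List.count_pos_iff.2 hws).ne'

theorem wordSum_eq_count_smul_add (w : List Z) (s : List (List Z)) :
    wordSum k s = (s.count w : k) • word k w + wordSum k (s.filter (· ≠ w)) := by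
  induction s with
  | nil => simp [wordSum]
  | cons v s ih =>
    rw [wordSum_cons, List.count_cons, List.filter_cons, ih]
    by_cases h : v = w
    · subst h
      simp [add_smul]
      abel
    · simp [h, wordSum_cons]
      abel

theorem HasLeadingWord.word_mem [CharZero k] {x : NCPoly k Z} {w : List Z} (h : HasLeadingWord x w)
    {N : Submodule k (NCPoly k Z)} (hx : x ∈ N)
    (hlen : ∀ v : List Z, v.length < w.length → word k v ∈ N)
    (hlt : ∀ v : List Z, v.Perm w → v < w → word k v ∈ N) : word k w ∈ N := by
  obtain ⟨s, hws, hs, hR⟩ := h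
  have h1 : x - wordSum k s ∈ N :=
    map_mem_of_mem_lengthFiltration LinearMap.id N (fun v hv => hlen v hv) hR
  have h2 : wordSum k (s.filter (· ≠ w)) ∈ N := by
    refine wordSum_mem fun v hv => ?_
    obtain ⟨hvs, hne⟩ := List.mem_filter.1 hv
    obtain ⟨hp, hle⟩ := hs v hvs
    exact hlt v hp (lt_of_le_of_ne hle (by simpa using hne))
  have h3 : (s.count w : k) • word k w ∈ N := by
    have := sub_mem (sub_mem hx h1) h2
    rwa [sub_sub_cancel, wordSum_eq_count_smul_add w s, add_sub_cancel_right] at this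
  have h4 : (s.count w : k) ≠ 0 := Nat.cast_ne_zero.2 (List.count_pos_iff.2 hws).ne'
  exact (Submodule.smul_mem_iff N h4).1 h3

/-- A submodule containing an element with each leading word is everything. -/
theorem word_mem_of_hasLeadingWord [CharZero k] {N : Submodule k (NCPoly k Z)}
    (h : ∀ w, ∃ x ∈ N, HasLeadingWord x w) (w : List Z) : word k w ∈ N := by
  obtain ⟨n, hn⟩ : ∃ n, w.length = n := ⟨_, rfl⟩
  induction n using Nat.strong_induction_on generalizing w with
  | _ n ihn =>
  -- The lexicographic order on words of a given length need not be well founded, but it is so on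
  -- the finite set of rearrangements of `w`.
  have hfin : {v : List Z | v.Perm w}.Finite := by
    refine (List.finite_toSet w.permutations).subset fun v hv => ?_
    exact List.mem_permutations.2 hv
  have hwf := hfin.wellFoundedOn (r := (· < ·))
  have key := hwf.induction (P := fun v => word k v ∈ N) (x := w) (List.Perm.refl w)
  refine key fun v hv ih => ?_
  obtain ⟨x, hx, hxv⟩ := h v
  refine hxv.word_mem hx (fun u hu => ihn _ ?_ u rfl) fun u hu hlt => ih u (hu.trans hv) hlt
  rw [← hn, ← List.Perm.length_eq hv]
  exact hu

theorem bijective_of_hasLeadingWord [CharZero k] {ι : Type*} (e : (ι →₀ k) →ₗ[k] NCPoly k Z)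
    (W : ι → List Z) (hW : Function.Bijective W)
    (he : ∀ i, HasLeadingWord (e (Finsupp.single i 1)) (W i)) : Function.Bijective e := by
  constructor
  · rw [← LinearMap.ker_eq_bot, LinearMap.ker_eq_bot']
    intro p hp
    by_contra hne
    -- Words are compared by length, then lexicographically: no other term of `p` contributes to the
    -- coefficient of the largest leading word.
    obtain ⟨i, hi, hmax⟩ := Finset.exists_max_image p.support
      (fun i => toLex ((W i).length, W i)) (Finsupp.support_nonempty_iff.2 hne)
    have hsum : e p = ∑ j ∈ p.support, p j • e (Finsupp.single j 1) := by
      conv_lhs => rw [← Finsupp.sum_single p, Finsupp.sum, map_sum]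
      refine Finset.sum_congr rfl fun j _ => ?_
      rw [← map_smul, Finsupp.smul_single_one]
    have h1 : wordCoeff k (W i) (e p) = p i * wordCoeff k (W i) (e (Finsupp.single i 1)) := by
      rw [hsum, map_sum, Finset.sum_eq_single_of_mem i hi, map_smul, smul_eq_mul]
      intro j hj hji
      have h2 := Prod.Lex.le_iff.1 (hmax j hj)
      simp only [ofLex_toLex] at h2
      rw [map_smul, (he j).wordCoeff_eq, smul_zero]
      · rcases h2 with h2 | h2
        · exact h2.le
        · exact h2.1.le
      · intro h3
        rcases h2 with h2 | h2
        · omega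
        · exact h2.2
      · exact fun h3 => hji (hW.1 h3).symm
    rw [hp, map_zero] at h1
    exact mul_ne_zero (Finsupp.mem_support_iff.1 hi) (he i).wordCoeff_ne_zero h1.symm
  · intro x
    have hw := word_mem_of_hasLeadingWord (N := LinearMap.range e) fun w => by
      obtain ⟨i, rfl⟩ := hW.2 w
      exact ⟨_, ⟨_, rfl⟩, he i⟩
    induction x using word_induction with
    | hw w => exact hw w
    | ha x y hx hy => exact (LinearMap.range e).add_mem hx hy
    | hs c x hx => exact (LinearMap.range e).smul_mem c hx

end Leading

/-! ### Monomials in Lyndon words. -/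

section Monomials
variable {Z : Type*} [LinearOrder Z]

/-- The concatenation, in non-increasing order, of the Lyndon words in a monomial. -/
noncomputable def monomialWord (m : {w : List Z // IsLyndon w} →₀ ℕ) : List Z :=
  ((m.toMultiset.sort (· ≥ ·)).map Subtype.val).flatten

theorem isLyndonSeq_map_val {ls : List {w : List Z // IsLyndon w}} :
    IsLyndonSeq (ls.map Subtype.val) ↔ ls.Pairwise (· ≥ ·) := by
  rw [IsLyndonSeq, List.pairwise_map]
  refine ⟨fun h => h.2, fun h => ⟨fun l hl => ?_, h⟩⟩
  obtain ⟨m, -, rfl⟩ := List.mem_map.1 hl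
  exact m.2

/-- A monomial is a multiset of Lyndon words, hence a unique non-increasing sequence; uniqueness and
existence of the factorisation give the two halves. -/
theorem monomialWord_bijective : Function.Bijective (monomialWord (Z := Z)) := by
  constructor
  · intro m n h
    have h1 := IsLyndonSeq.eq_of_flatten_eq
      (isLyndonSeq_map_val.2 (Multiset.pairwise_sort m.toMultiset (· ≥ ·)))
      (isLyndonSeq_map_val.2 (Multiset.pairwise_sort n.toMultiset (· ≥ ·))) h
    have h2 := List.map_injective_iff.2 Subtype.val_injective h1
    classical
    rw [← Finsupp.toMultiset_toFinsupp m, ← Finsupp.toMultiset_toFinsupp n]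
    rw [← Multiset.sort_eq m.toMultiset (· ≥ ·), h2, Multiset.sort_eq]
  · intro w
    obtain ⟨ls, hls, rfl⟩ := exists_isLyndonSeq_flatten_eq w
    lift ls to List {w : List Z // IsLyndon w} using hls.1
    refine ⟨Multiset.toFinsupp (ls : Multiset _), ?_⟩
    rw [monomialWord, Multiset.toFinsupp_toMultiset, Multiset.coe_sort,
      List.mergeSort_eq_self _ (isLyndonSeq_map_val.1 hls)]

theorem prod_map_X {k σ : Type*} [CommSemiring k] [DecidableEq σ] (ls : List σ) :
    (ls.map (MvPolynomial.X (R := k))).prod =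
      MvPolynomial.monomial (Multiset.toFinsupp (ls : Multiset σ)) 1 := by
  induction ls with
  | nil => simp
  | cons a ls ih =>
    rw [List.map_cons, List.prod_cons, ih, MvPolynomial.X, MvPolynomial.monomial_mul, mul_one,
      ← Multiset.cons_coe, ← Multiset.singleton_add, map_add, Multiset.toFinsupp_singleton]

theorem hasLeadingWord_prod_X {k Z : Type*} [Field k] [LinearOrder Z]
    {d : (Z →₀ k) →ₗ[k] (Z →₀ k) →ₗ[k] (Z →₀ k)}
    {e : MvPolynomial {w : List Z // IsLyndon w} k →ₗ[k] NCPoly k Z}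
    (h1 : e 1 = word k []) (hmul : ∀ p q, e (p * q) = star d (e p) (e q))
    (hX : ∀ w, e (MvPolynomial.X w) = word k w.1) {ls : List {w : List Z // IsLyndon w}}
    (hls : IsLyndonSeq (ls.map Subtype.val)) :
    HasLeadingWord (e (ls.map MvPolynomial.X).prod) (ls.map Subtype.val).flatten := by
  induction ls with
  | nil =>
    rw [List.map_nil, List.prod_nil, h1]
    exact hasLeadingWord_word _
  | cons l ls ih =>
    rw [List.map_cons, List.prod_cons, hmul, hX]
    exact HasLeadingWord.star hls (ih (isLyndonSeq_cons.1 hls).2.2)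

end Monomials
end GenQuasiShuffle

theorem mainTheorem2 {Z : Type*} [Countable Z] [LinearOrder Z]
    (d : (Z →₀ ℚ) →ₗ[ℚ] (Z →₀ ℚ) →ₗ[ℚ] (Z →₀ ℚ))
    (d_comm : ∀ x y : Z →₀ ℚ, d x y = d y x)
    (d_assoc : ∀ x y z : Z →₀ ℚ, d (d x y) z = d x (d y z)) :
    ∃ e : MvPolynomial {w : List Z // GenQuasiShuffle.IsLyndon w} ℚ ≃ₗ[ℚ]
        GenQuasiShuffle.NCPoly ℚ Z,
      e 1 = GenQuasiShuffle.word ℚ [] ∧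
      (∀ p q, e (p * q) = GenQuasiShuffle.star d (e p) (e q)) ∧
      ∀ w : {w : List Z // GenQuasiShuffle.IsLyndon w},
        e (MvPolynomial.X w) = GenQuasiShuffle.word ℚ w.1 := by
  obtain ⟨e, h1, hmul, hX⟩ := GenQuasiShuffle.exists_linearMap_star d_comm d_assoc
    fun w : {w : List Z // GenQuasiShuffle.IsLyndon w} => GenQuasiShuffle.word ℚ w.1
  let b := MvPolynomial.basisMonomials {w : List Z // GenQuasiShuffle.IsLyndon w} ℚ
  have hbij : Function.Bijective (e ∘ₗ b.repr.symm.toLinearMap) := by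
    refine GenQuasiShuffle.bijective_of_hasLeadingWord _ GenQuasiShuffle.monomialWord
      GenQuasiShuffle.monomialWord_bijective fun m => ?_
    have h := GenQuasiShuffle.hasLeadingWord_prod_X h1 hmul hX (GenQuasiShuffle.isLyndonSeq_map_val.2
      (Multiset.pairwise_sort m.toMultiset (· ≥ ·)))
    rw [GenQuasiShuffle.prod_map_X, Multiset.sort_eq, Finsupp.toMultiset_toFinsupp] at h
    have hb : b.repr.symm (Finsupp.single m 1) = MvPolynomial.monomial m 1 := by
      rw [Module.Basis.repr_symm_single_one, MvPolynomial.coe_basisMonomials]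
    rw [LinearMap.comp_apply, LinearEquiv.coe_coe, hb]
    exact h
  have he : Function.Bijective e := by
    rw [LinearMap.coe_comp] at hbij
    exact (Function.Bijective.of_comp_iff e b.repr.symm.bijective).1 hbij
  exact ⟨LinearEquiv.ofBijective e he, h1, hmul, hX⟩
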